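/- Let $\mu,\nu,\sigma>0$, and let $(\alpha_k)_{k\ge1}$, $(\beta_k)_{k\ge1}$, $(\gamma_k)_{k\ge1}$ be random variables on a probability space, all of them (jointly) independent, such that for every $k$ the variables $\alpha_k,\beta_k,\gamma_k$ are exponentially distributed with parameters (rates) $\mu,\nu,\sigma$ respectively. Consider the linear system $\boldsymbol z(k)=A(k)\boldsymbol z(k-1)$ over the semiring of real numbers with the operations maximum and addition, with $$A(k)=\begin{pmatrix}\alpha_k&\beta_k\\ \gamma_k&0\end{pmatrix},\qquad \boldsymbol z(k)=\begin{pmatrix}x(k)\\ y(k)\end{pmatrix},\qquad x(0)=y(0)=0,$$ that is, $x(k)=\max(x(k-1)+\alpha_k,\;y(k-1)+\beta_k)$ and $y(k)=\max(x(k-1)+\gamma_k,\;y(k-1))$ for $k\ge1$. In each of the two cases below, the limit $$\lambda=\lim_{k\to\infty}\frac1k\max(x(k),y(k))$$ (the Lyapunov exponent of the system) exists almost surely and is almost surely equal to the stated constant. (1) If $\sigma=\mu$, then $$\lambda=\frac{48\mu^{5}+238\mu^{4}\nu+495\mu^{3}\nu^{2}+581\mu^{2}\nu^{3}+326\mu\nu^{4}+68\nu^{5}}{2\mu\nu\,(36\mu^{4}+147\mu^{3}\nu+215\mu^{2}\nu^{2}+130\mu\nu^{3}+28\nu^{4})}.$$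 (2) If $\sigma=\nu$, then $\lambda=P(\mu,\nu)/Q(\mu,\nu)$, where $$P(\mu,\nu)=15\mu^{8}+152\mu^{7}\nu+624\mu^{6}\nu^{2}+1382\mu^{5}\nu^{3}+1838\mu^{4}\nu^{4}+1592\mu^{3}\nu^{5}+973\mu^{2}\nu^{6}+384\mu\nu^{7}+64\nu^{8},$$ $$Q(\mu,\nu)=\mu\nu(\mu+\nu)^{2}(12\mu^{5}+97\mu^{4}\nu+286\mu^{3}\nu^{2}+397\mu^{2}\nu^{3}+256\mu\nu^{4}+64\nu^{5}).$$ -/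

import Mathlib

open MeasureTheory ProbabilityTheory Filter Topology

/-- The product of a `2 × 2` matrix and a vector over the semiring of real numbers in which the
addition is the maximum and the multiplication is the ordinary addition. -/
def maxPlusMulVec (A : Matrix (Fin 2) (Fin 2) ℝ) (v : Fin 2 → ℝ) : Fin 2 → ℝ :=
  fun i => max (v 0 + A i 0) (v 1 + A i 1)

/-- The trajectory of the max-plus linear system `z (k + 1) = A k ⊗ z k` started at `z 0 = 0`.
The matrix called `A k` here acts in the step from time `k` to time `k + 1`. -/
def maxPlusState (A : ℕ → Matrix (Fin 2) (Fin 2) ℝ) : ℕ → Fin 2 → ℝ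
  | 0 => 0
  | k + 1 => maxPlusMulVec (A k) (maxPlusState A k)

/-- `l` is the Lyapunov exponent of the random max-plus linear system with state transition
matrices `A 0, A 1, …`: with probability one, `max (x k) (y k) / k → l` as `k → ∞`, where
`x k`, `y k` are the coordinates of the state vector. -/
def IsLyapunovExponent {Ω : Type*} [MeasurableSpace Ω] (P : Measure Ω)
    (A : ℕ → Ω → Matrix (Fin 2) (Fin 2) ℝ) (l : ℝ) : Prop :=
  ∀ᵐ ω ∂P, Tendsto
    (fun k : ℕ => (1 / (k : ℝ)) *
      max (maxPlusState (fun j => A j ω) k 0) (maxPlusState (fun j => A j ω) k 1))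
    atTop (𝓝 l)

/-! ### The exponential distribution -/

/-! Write `M = max x y` and `d = x - y`, with primes for the next state. The increment of `M` and
the value of `d'` depend on the past only through `d`. So it suffices to find a number `l` and a
bounded function `g` solving the Poisson equation `E[M' - M + g(d') | d] = g(d) + l`. Then `M + g(d)
- l n` is a martingale with increments bounded in L², hence almost surely `o(n)` along the squares;
since `g` is bounded and `M` is nondecreasing, `M / n → l` along all integers
(`isLyapunovExponent_of_poisson`).

The equation is explicitly solvable because exponentials are memoryless. Relative to `M`, the
entries act only through the positive parts of `α - d⁻`, `β - d⁺`, `γ - d⁻`, and each of these is a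
mixture of `0` and the untruncated exponential. Whatever `g` is, the left side is therefore a
mixture of five constants, with weights built from `exp(-ν d⁺)`, `exp(-μ d⁻)`, `exp(-σ d⁻)`. These
constants are the expectations with all entries present (value `l`, which normalises `g 0 = 0`),
with `β` suppressed (`A + l`), `α` and `γ` suppressed (`C + l`), `γ` suppressed (`D + l`), and `α`
suppressed (`E + l`). This dictates the form of `corrector` and turns the equation into five linear
equations for `A, C, D, E, l` (`integral_correctedStep`).

Their coefficients are rational in the rates: minima of independent exponentials are exponential
(`hasLaw_min_exp`), a difference is a mixture of an exponential and a negated one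
(`integral_comp_sub_exp`), and maxima reduce to minima. When `σ = μ` or `σ = ν`, solving the system
gives the stated constants. -/

lemma measureReal_expMeasure_Ioi {r : ℝ} (hr : 0 < r) (t : ℝ) :
    (expMeasure r).real (Set.Ioi t) = Real.exp (-(r * max t 0)) := by
  have := isProbabilityMeasure_expMeasure hr
  rw [← Set.compl_Iic, probReal_compl_eq_one_sub measurableSet_Iic, ← cdf_eq_real,
    cdf_expMeasure_eq hr]
  split_ifs with h
  · rw [max_eq_left h]; ring
  · rw [max_eq_right (not_le.1 h).le]; simp

/-- Laws are compared through tails because minima and truncations of exponentials have purely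
exponential tails on the positive axis. -/
lemma MeasureTheory.Measure.eq_of_measureReal_Ioi {m₁ m₂ : Measure ℝ} [IsProbabilityMeasure m₁]
    [IsProbabilityMeasure m₂] (h : ∀ t, m₁.real (Set.Ioi t) = m₂.real (Set.Ioi t)) :
    m₁ = m₂ := by
  refine Measure.eq_of_cdf _ _ (StieltjesFunction.ext fun t => ?_)
  have := h t
  rw [← Set.compl_Iic, probReal_compl_eq_one_sub measurableSet_Iic,
    probReal_compl_eq_one_sub measurableSet_Iic] at this
  rw [cdf_eq_real, cdf_eq_real]
  linarith

lemma ae_pos_expMeasure {r : ℝ} (hr : 0 < r) : ∀ᵐ x ∂(expMeasure r), 0 < x := by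
  have := isProbabilityMeasure_expMeasure hr
  have h : (expMeasure r).real (Set.Ioi 0) = 1 := by simp [measureReal_expMeasure_Ioi hr]
  have h2 : expMeasure r (Set.Ioi 0) = 1 := by
    rw [measureReal_def] at h
    exact (ENNReal.toReal_eq_one_iff _).1 h
  exact (prob_compl_eq_zero_iff measurableSet_Ioi).2 h2

lemma expMeasure_eq_withDensity {r : ℝ} :
    expMeasure r = (volume.restrict (Set.Ioi 0)).withDensity
      (fun x => ENNReal.ofReal (r * Real.exp (-(r * x)))) := by
  have : expMeasure r = volume.withDensity
      ((Set.Ici 0).indicator fun x => ENNReal.ofReal (r * Real.exp (-(r * x)))) := by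
    unfold expMeasure gammaMeasure
    congr 1
    ext x
    by_cases hx : 0 ≤ x
    · simp [gammaPDF_of_nonneg hx, hx]
    · simp [gammaPDF_of_neg (not_le.1 hx), hx]
  rw [this, withDensity_indicator measurableSet_Ici]
  congr 1
  exact Measure.restrict_congr_set Ioi_ae_eq_Ici.symm

lemma integral_expMeasure {r : ℝ} (hr : 0 < r) (f : ℝ → ℝ) :
    ∫ x, f x ∂(expMeasure r) = ∫ x in Set.Ioi 0, r * Real.exp (-(r * x)) * f x := by
  rw [expMeasure_eq_withDensity, integral_withDensity_eq_integral_toReal_smul (by fun_prop)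
    (by simp)]
  refine integral_congr_ae (ae_of_all _ fun x => ?_)
  simp only [smul_eq_mul]
  rw [ENNReal.toReal_ofReal (by positivity)]

lemma integrable_expMeasure_iff {r : ℝ} (hr : 0 < r) (f : ℝ → ℝ) :
    Integrable f (expMeasure r) ↔
      IntegrableOn (fun x => r * Real.exp (-(r * x)) * f x) (Set.Ioi 0) := by
  rw [expMeasure_eq_withDensity, integrable_withDensity_iff_integrable_smul' (by fun_prop)
    (by simp), IntegrableOn]
  refine integrable_congr (ae_of_all _ fun x => ?_)
  simp only [smul_eq_mul]
  rw [ENNReal.toReal_ofReal (by positivity)]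

lemma integral_exp_neg_mul_expMeasure {r c : ℝ} (hr : 0 < r) (hc : 0 ≤ c) :
    ∫ x, Real.exp (-(c * x)) ∂(expMeasure r) = r / (r + c) := by
  rw [integral_expMeasure hr]
  have h : ∀ x : ℝ, r * Real.exp (-(r * x)) * Real.exp (-(c * x))
      = r * Real.exp (-(r + c) * x) := fun x => by
    rw [mul_assoc, ← Real.exp_add]; ring_nf
  simp_rw [h]
  rw [integral_const_mul, integral_exp_mul_Ioi (by linarith)]
  rw [mul_zero, Real.exp_zero, neg_div_neg_eq, mul_one_div]

lemma integrable_exp_neg_mul_expMeasure {r c : ℝ} (hr : 0 < r) (hc : 0 ≤ c) :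
    Integrable (fun x => Real.exp (-(c * x))) (expMeasure r) := by
  have := isProbabilityMeasure_expMeasure hr
  refine Integrable.of_bound (by fun_prop) 1 ?_
  filter_upwards [ae_pos_expMeasure hr] with x hx
  rw [Real.norm_eq_abs, Real.abs_exp, Real.exp_le_one_iff]
  nlinarith

lemma integrable_pow_expMeasure {r : ℝ} (hr : 0 < r) (n : ℕ) :
    Integrable (fun x => x ^ n) (expMeasure r) := by
  rw [integrable_expMeasure_iff hr]
  have h := integrableOn_rpow_mul_exp_neg_mul_rpow (s := n) (p := 1) (b := r)
    (by have : (0 : ℝ) ≤ n := n.cast_nonneg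
        linarith) one_pos hr
  refine IntegrableOn.congr_fun (h.const_mul r) (fun x _ => ?_) measurableSet_Ioi
  simp only [Real.rpow_natCast, Real.rpow_one, neg_mul]
  ring

lemma integral_id_expMeasure {r : ℝ} (hr : 0 < r) : ∫ x, x ∂(expMeasure r) = 1 / r := by
  rw [integral_expMeasure hr]
  have h := Real.integral_rpow_mul_exp_neg_mul_Ioi (a := 2) two_pos hr
  have h2 : ∀ x ∈ Set.Ioi (0 : ℝ), r * Real.exp (-(r * x)) * x
      = r * (x ^ ((2 : ℝ) - 1) * Real.exp (-(r * x))) := fun x _ => by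
    norm_num; ring
  rw [setIntegral_congr_fun measurableSet_Ioi h2, integral_const_mul, h]
  simp
  field_simp

/-- Memorylessness of the exponential distribution. -/
lemma map_posPart_sub_expMeasure {r c : ℝ} (hr : 0 < r) (hc : 0 ≤ c) :
    (expMeasure r).map (fun x => max (x - c) 0) =
      ENNReal.ofReal (1 - Real.exp (-(r * c))) • Measure.dirac 0 +
        ENNReal.ofReal (Real.exp (-(r * c))) • expMeasure r := by
  have := isProbabilityMeasure_expMeasure hr
  have hm : Measurable fun x : ℝ => max (x - c) 0 := by fun_prop
  have hfin₁ := (Measure.dirac (0 : ℝ)).smul_finite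
    (ENNReal.ofReal_ne_top (r := 1 - Real.exp (-(r * c))))
  have hfin₂ := (expMeasure r).smul_finite (ENNReal.ofReal_ne_top (r := Real.exp (-(r * c))))
  have h1 : Real.exp (-(r * c)) ≤ 1 := Real.exp_le_one_iff.2 (by nlinarith)
  have := Measure.isProbabilityMeasure_map (μ := expMeasure r) hm.aemeasurable
  have : IsProbabilityMeasure (ENNReal.ofReal (1 - Real.exp (-(r * c))) • Measure.dirac (0 : ℝ) +
        ENNReal.ofReal (Real.exp (-(r * c))) • expMeasure r) := ⟨by
    simp only [Measure.coe_add, Measure.coe_smul, Pi.add_apply, Pi.smul_apply, measure_univ,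
      smul_eq_mul, mul_one]
    rw [← ENNReal.ofReal_add (by linarith) (Real.exp_pos _).le]
    simp⟩
  refine Measure.eq_of_measureReal_Ioi fun t => ?_
  rw [map_measureReal_apply hm measurableSet_Ioi, measureReal_add_apply,
    measureReal_ennreal_smul_apply, measureReal_ennreal_smul_apply,
    ENNReal.toReal_ofReal (by linarith), ENNReal.toReal_ofReal (Real.exp_pos _).le,
    measureReal_expMeasure_Ioi hr]
  rcases le_or_gt 0 t with ht | ht
  · have : (fun x : ℝ => max (x - c) 0) ⁻¹' Set.Ioi t = Set.Ioi (t + c) := by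
      ext x
      simp only [Set.mem_preimage, Set.mem_Ioi, lt_max_iff, not_lt.2 ht, or_false]
      exact lt_sub_iff_add_lt
    rw [this, measureReal_expMeasure_Ioi hr, max_eq_left ht, max_eq_left (by linarith),
      measureReal_def]
    simp [ht, ← Real.exp_add]
    ring
  · have : (fun x : ℝ => max (x - c) 0) ⁻¹' Set.Ioi t = Set.univ := by
      ext x
      simp [ht]
    rw [this, max_eq_right ht.le, measureReal_def, measureReal_def]
    simp [ht]

lemma integral_posPart_sub_expMeasure {r c : ℝ} (hr : 0 < r) (hc : 0 ≤ c) {f : ℝ → ℝ}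
    (hf : Measurable f) (hi : Integrable f (expMeasure r)) :
    ∫ x, f (max (x - c) 0) ∂(expMeasure r) =
      (1 - Real.exp (-(r * c))) * f 0 + Real.exp (-(r * c)) * ∫ x, f x ∂(expMeasure r) := by
  have h1 : Real.exp (-(r * c)) ≤ 1 := Real.exp_le_one_iff.2 (by nlinarith)
  have hm : Measurable fun x : ℝ => max (x - c) 0 := by fun_prop
  rw [← integral_map hm.aemeasurable hf.aestronglyMeasurable, map_posPart_sub_expMeasure hr hc,
    integral_add_measure ((integrable_dirac (by simp)).smul_measure ENNReal.ofReal_ne_top)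
      (hi.smul_measure ENNReal.ofReal_ne_top), integral_smul_measure, integral_smul_measure,
    integral_dirac, ENNReal.toReal_ofReal (by linarith), ENNReal.toReal_ofReal (Real.exp_pos _).le]
  rfl

/-! ### Functions of independent random variables -/

lemma ProbabilityTheory.IndepFun.integral_comp_prodMk {Ω E E' : Type*} [MeasurableSpace Ω]
    [MeasurableSpace E] [MeasurableSpace E'] {P : Measure Ω} [IsProbabilityMeasure P]
    {U : Ω → E} {W : Ω → E'} (h : IndepFun U W P) (hU : Measurable U) (hW : Measurable W)
    {f : E → E' → ℝ} (hf : Measurable (Function.uncurry f))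
    (hi : Integrable (fun ω => f (U ω) (W ω)) P) :
    ∫ ω, f (U ω) (W ω) ∂P = ∫ ω, ∫ ω', f (U ω) (W ω') ∂P ∂P := by
  have hmap := (indepFun_iff_map_prod_eq_prod_map_map hU.aemeasurable hW.aemeasurable).1 h
  have hUW : Measurable fun ω => (U ω, W ω) := hU.prodMk hW
  have := Measure.isProbabilityMeasure_map (μ := P) hU.aemeasurable
  have := Measure.isProbabilityMeasure_map (μ := P) hW.aemeasurable
  have hi' : Integrable (Function.uncurry f) ((P.map U).prod (P.map W)) := by
    rw [← hmap, integrable_map_measure hf.aestronglyMeasurable hUW.aemeasurable]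
    exact hi
  calc ∫ ω, f (U ω) (W ω) ∂P = ∫ p, Function.uncurry f p ∂(P.map fun ω => (U ω, W ω)) :=
        (integral_map hUW.aemeasurable hf.aestronglyMeasurable).symm
    _ = ∫ u, ∫ w, f u w ∂(P.map W) ∂(P.map U) := by
        rw [hmap, integral_prod _ hi']; rfl
    _ = ∫ u, ∫ ω', f u (W ω') ∂P ∂(P.map U) := by
        congr 1; ext u
        exact integral_map hW.aemeasurable (by fun_prop)
    _ = _ := by
        refine integral_map (f := fun u => ∫ ω', f u (W ω') ∂P) hU.aemeasurable ?_
        refine StronglyMeasurable.aestronglyMeasurable ?_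
        have : Measurable (Function.uncurry fun u ω' => f u (W ω')) :=
          hf.comp (measurable_fst.prodMk (hW.comp measurable_snd))
        exact this.stronglyMeasurable.integral_prod_right

/-! ### Truncations, minima and differences of independent exponential variables -/

section ExponentialVariables

variable {Ω : Type*} [MeasurableSpace Ω] {P : Measure Ω}

lemma ProbabilityTheory.HasLaw.ae_pos_of_exp {X : Ω → ℝ} {r : ℝ} (hX : HasLaw X (expMeasure r) P)
    (hr : 0 < r) : ∀ᵐ ω ∂P, 0 < X ω := by
  have h := ae_pos_expMeasure hr
  rw [← hX.map_eq] at h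
  exact ae_of_ae_map hX.aemeasurable h

lemma ProbabilityTheory.HasLaw.integrable_comp_iff {X : Ω → ℝ} {m : Measure ℝ}
    (hX : HasLaw X m P) {f : ℝ → ℝ} (hf : Measurable f) :
    Integrable (fun ω => f (X ω)) P ↔ Integrable f m := by
  rw [← hX.map_eq]
  exact (integrable_map_measure hf.aestronglyMeasurable hX.aemeasurable).symm

lemma ProbabilityTheory.HasLaw.integrable_pow_of_exp {X : Ω → ℝ} {r : ℝ}
    (hX : HasLaw X (expMeasure r) P) (hr : 0 < r) (n : ℕ) : Integrable (fun ω => X ω ^ n) P :=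
  (hX.integrable_comp_iff (measurable_id.pow_const n)).2 (integrable_pow_expMeasure hr n)

lemma ProbabilityTheory.HasLaw.integrable_of_exp {X : Ω → ℝ} {r : ℝ}
    (hX : HasLaw X (expMeasure r) P) (hr : 0 < r) : Integrable X P := by
  simpa using hX.integrable_pow_of_exp hr 1

variable [IsProbabilityMeasure P]

/-- Memorylessness in the presence of an independent variable: Fubini freezes `X`, and the
one-variable identity applies to each section. -/
lemma ProbabilityTheory.IndepFun.integral_comp_posPart_sub_const {E : Type*} [MeasurableSpace E]
    {X : Ω → E} {Y : Ω → ℝ} {r c : ℝ} (h : IndepFun X Y P) (hX : Measurable X) (hY : Measurable Y)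
    (hYr : HasLaw Y (expMeasure r) P) (hr : 0 < r) (hc : 0 ≤ c) {F : E → ℝ → ℝ}
    (hF : Measurable (Function.uncurry F)) (hi : ∀ x, Integrable (fun ω => F x (Y ω)) P)
    (hi₀ : Integrable (fun ω => F (X ω) 0) P) (hi₁ : Integrable (fun ω => F (X ω) (Y ω)) P)
    (hi₂ : Integrable (fun ω => F (X ω) (max (Y ω - c) 0)) P) :
    ∫ ω, F (X ω) (max (Y ω - c) 0) ∂P =
      (1 - Real.exp (-(r * c))) * ∫ ω, F (X ω) 0 ∂P +
        Real.exp (-(r * c)) * ∫ ω, F (X ω) (Y ω) ∂P := by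
  have hi₃ : Integrable (fun ω => ∫ ω', F (X ω) (Y ω') ∂P) P := by
    have := Measure.isProbabilityMeasure_map (μ := P) hX.aemeasurable
    have := Measure.isProbabilityMeasure_map (μ := P) hY.aemeasurable
    have hmap := (indepFun_iff_map_prod_eq_prod_map_map hX.aemeasurable hY.aemeasurable).1 h
    have hi' : Integrable (Function.uncurry F) ((P.map X).prod (P.map Y)) := by
      rw [← hmap, integrable_map_measure hF.aestronglyMeasurable (hX.prodMk hY).aemeasurable]
      exact hi₁
    have h2 := hi'.integral_prod_left
    have h3 := (integrable_map_measure h2.aestronglyMeasurable hX.aemeasurable).1 h2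
    refine h3.congr (ae_of_all _ fun ω => ?_)
    exact integral_map hY.aemeasurable (by simpa using (hF.of_uncurry_left).aestronglyMeasurable)
  have hm : Measurable (Function.uncurry fun x y => F x (max (y - c) 0)) :=
    hF.comp (measurable_fst.prodMk ((measurable_snd.sub_const c).max measurable_const))
  rw [h.integral_comp_prodMk hX hY hm hi₂, h.integral_comp_prodMk hX hY hF hi₁,
    ← integral_const_mul, ← integral_const_mul, ← integral_add (hi₀.const_mul _) (hi₃.const_mul _)]
  refine integral_congr_ae (ae_of_all _ fun ω => ?_)
  have hFx : Measurable (F (X ω)) := hF.of_uncurry_left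
  have e₁ := hYr.integral_comp (f := fun y => F (X ω) (max (y - c) 0))
    (hFx.comp ((measurable_id.sub_const c).max measurable_const)).aestronglyMeasurable
  have e₂ := hYr.integral_comp (f := F (X ω)) hFx.aestronglyMeasurable
  simp only [Function.comp_def] at e₁ e₂
  simp only
  rw [e₁, e₂]
  exact integral_posPart_sub_expMeasure hr hc hFx ((hYr.integrable_comp_iff hFx).1 (hi _))

lemma hasLaw_min_exp {X Y : Ω → ℝ} {r s : ℝ} (h : IndepFun X Y P) (hX : Measurable X)
    (hY : Measurable Y) (hXr : HasLaw X (expMeasure r) P) (hYs : HasLaw Y (expMeasure s) P)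
    (hr : 0 < r) (hs : 0 < s) :
    HasLaw (fun ω => min (X ω) (Y ω)) (expMeasure (r + s)) P := by
  have hm : Measurable fun ω => min (X ω) (Y ω) := hX.min hY
  refine ⟨hm.aemeasurable, ?_⟩
  have := isProbabilityMeasure_expMeasure (add_pos hr hs)
  have := Measure.isProbabilityMeasure_map (μ := P) hm.aemeasurable
  refine Measure.eq_of_measureReal_Ioi fun t => ?_
  rw [map_measureReal_apply hm measurableSet_Ioi, measureReal_expMeasure_Ioi (add_pos hr hs)]
  have e : (fun ω => min (X ω) (Y ω)) ⁻¹' Set.Ioi t = X ⁻¹' Set.Ioi t ∩ Y ⁻¹' Set.Ioi t := by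
    ext ω; simp
  rw [e, measureReal_def, h.measure_inter_preimage_eq_mul _ _ measurableSet_Ioi measurableSet_Ioi,
    ENNReal.toReal_mul, ← measureReal_def, ← measureReal_def,
    ← map_measureReal_apply hX measurableSet_Ioi, ← map_measureReal_apply hY measurableSet_Ioi,
    hXr.map_eq, hYs.map_eq, measureReal_expMeasure_Ioi hr, measureReal_expMeasure_Ioi hs,
    ← Real.exp_add]
  ring_nf

/-- Condition on `Y` and use memorylessness with the random shift `c = Y`; the weight averages to
`E[exp(-r Y)] = s / (r + s)`. -/
lemma integral_comp_posPart_sub_exp {X Y : Ω → ℝ} {r s C : ℝ} (h : IndepFun X Y P)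
    (hX : Measurable X) (hY : Measurable Y) (hXr : HasLaw X (expMeasure r) P)
    (hYs : HasLaw Y (expMeasure s) P) (hr : 0 < r) (hs : 0 < s) {f : ℝ → ℝ} (hf : Measurable f)
    (hC : ∀ x, |f x| ≤ C) :
    ∫ ω, f (max (X ω - Y ω) 0) ∂P =
      r / (r + s) * f 0 + s / (r + s) * ∫ x, f x ∂(expMeasure r) := by
  have := isProbabilityMeasure_expMeasure hs
  have := isProbabilityMeasure_expMeasure hr
  have hm : Measurable (Function.uncurry fun y x => f (max (x - y) 0)) :=
    hf.comp ((measurable_snd.sub measurable_fst).max measurable_const)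
  have hi : Integrable (fun ω => f (max (X ω - Y ω) 0)) P :=
    Integrable.of_bound (hf.comp ((hX.sub hY).max measurable_const)).aestronglyMeasurable C
      (ae_of_all _ fun ω => hC _)
  have hie := integrable_exp_neg_mul_expMeasure hs hr.le
  rw [h.symm.integral_comp_prodMk hY hX hm hi]
  have e : ∀ᵐ ω ∂P, ∫ ω', f (max (X ω' - Y ω) 0) ∂P =
      (1 - Real.exp (-(r * Y ω))) * f 0 + Real.exp (-(r * Y ω)) * ∫ x, f x ∂(expMeasure r) := by
    filter_upwards [hYs.ae_pos_of_exp hs] with ω hω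
    rw [← integral_posPart_sub_expMeasure hr hω.le hf
      (Integrable.of_bound hf.aestronglyMeasurable C (ae_of_all _ hC))]
    exact hXr.integral_comp (f := fun x => f (max (x - Y ω) 0))
      (hf.comp ((measurable_id.sub_const _).max measurable_const)).aestronglyMeasurable
  rw [integral_congr_ae e]
  have e₂ := hYs.integral_comp
    (f := fun y => (1 - Real.exp (-(r * y))) * f 0 + Real.exp (-(r * y)) * ∫ x, f x ∂(expMeasure r))
    (by fun_prop)
  simp only [Function.comp_def] at e₂
  have e₃ : ∀ y, (1 - Real.exp (-(r * y))) * f 0 + Real.exp (-(r * y)) * ∫ x, f x ∂(expMeasure r)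
      = f 0 + Real.exp (-(r * y)) * (∫ x, f x ∂(expMeasure r) - f 0) := fun y => by ring
  rw [e₂]
  simp_rw [e₃]
  rw [integral_add (integrable_const _) (hie.mul_const _), integral_mul_const,
    integral_exp_neg_mul_expMeasure hs hr.le]
  simp only [integral_const, probReal_univ, smul_eq_mul]
  field_simp
  ring

lemma integral_comp_sub_exp {X Y : Ω → ℝ} {r s C : ℝ} (h : IndepFun X Y P)
    (hX : Measurable X) (hY : Measurable Y) (hXr : HasLaw X (expMeasure r) P)
    (hYs : HasLaw Y (expMeasure s) P) (hr : 0 < r) (hs : 0 < s) {f : ℝ → ℝ} (hf : Measurable f)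
    (hC : ∀ x, |f x| ≤ C) :
    ∫ ω, f (X ω - Y ω) ∂P =
      s / (r + s) * ∫ x, f x ∂(expMeasure r) + r / (r + s) * ∫ x, f (-x) ∂(expMeasure s) := by
  have h₁ := integral_comp_posPart_sub_exp h hX hY hXr hYs hr hs hf hC
  have h₂ := integral_comp_posPart_sub_exp h.symm hY hX hYs hXr hs hr
    (f := fun x => f (-x)) (by fun_prop) (fun x => hC _)
  have hb : ∀ Z : Ω → ℝ, Measurable Z → Integrable (fun ω => f (Z ω)) P := fun Z hZ =>
    Integrable.of_bound (hf.comp hZ).aestronglyMeasurable C (ae_of_all _ fun ω => hC _)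
  -- One of the two positive parts is always zero and contributes `f 0`, which is subtracted.
  have e : ∀ ω, f (X ω - Y ω) =
      f (max (X ω - Y ω) 0) + f (-max (Y ω - X ω) 0) - f 0 := fun ω => by
    rcases le_total (X ω) (Y ω) with hle | hle
    · rw [max_eq_right (by linarith), max_eq_left (by linarith)]; ring_nf
    · rw [max_eq_left (by linarith), max_eq_right (a := Y ω - X ω) (by linarith)]; ring_nf
  simp_rw [e]
  have i₁ := hb (fun ω => max (X ω - Y ω) 0) (by fun_prop)
  have i₂ := hb (fun ω => -max (Y ω - X ω) 0) (by fun_prop)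
  have i₃ : Integrable (fun ω => f (max (X ω - Y ω) 0) + f (-max (Y ω - X ω) 0)) P := i₁.add i₂
  rw [integral_sub i₃ (integrable_const _), integral_add i₁ i₂, h₁, h₂]
  simp only [integral_const, probReal_univ, smul_eq_mul, neg_zero]
  field_simp
  ring

end ExponentialVariables

/-! ### The corrector -/

/-- A function of the difference of the two coordinates of the state which, for suitable
coefficients, solves the Poisson equation of the system. -/
noncomputable def corrector (μ ν σ A C D E d : ℝ) : ℝ :=
  A * (1 - Real.exp (-(ν * max d 0))) +
  C * ((1 - Real.exp (-(μ * max (-d) 0))) * (1 - Real.exp (-(σ * max (-d) 0)))) +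
  D * (Real.exp (-(μ * max (-d) 0)) * (1 - Real.exp (-(σ * max (-d) 0)))) +
  E * ((1 - Real.exp (-(μ * max (-d) 0))) * Real.exp (-(σ * max (-d) 0)))

section Corrector

variable {μ ν σ : ℝ} (A C D E : ℝ)

lemma measurable_corrector : Measurable (corrector μ ν σ A C D E) := by
  unfold corrector
  fun_prop

lemma corrector_zero : corrector μ ν σ A C D E 0 = 0 := by
  simp [corrector]

lemma abs_corrector_le (hμ : 0 < μ) (hν : 0 < ν) (hσ : 0 < σ) (d : ℝ) :
    |corrector μ ν σ A C D E d| ≤ |A| + |C| + |D| + |E| := by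
  have key : ∀ r : ℝ, 0 < r → ∀ t : ℝ, 0 ≤ Real.exp (-(r * max t 0)) ∧
      Real.exp (-(r * max t 0)) ≤ 1 := fun r hr t =>
    ⟨(Real.exp_pos _).le, Real.exp_le_one_iff.2 (by
      have := mul_nonneg hr.le (le_max_right t 0)
      linarith)⟩
  obtain ⟨w₀, w₁⟩ := key ν hν d
  obtain ⟨p₀, p₁⟩ := key μ hμ (-d)
  obtain ⟨q₀, q₁⟩ := key σ hσ (-d)
  have mul_le : ∀ k t : ℝ, 0 ≤ t → t ≤ 1 → |k * t| ≤ |k| := fun k t h₀ h₁ => by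
    rw [abs_mul, abs_of_nonneg h₀]
    exact mul_le_of_le_one_right (abs_nonneg _) h₁
  unfold corrector
  generalize Real.exp (-(ν * max d 0)) = w at *
  generalize Real.exp (-(μ * max (-d) 0)) = p at *
  generalize Real.exp (-(σ * max (-d) 0)) = q at *
  have hA := mul_le A (1 - w) (by linarith) (by linarith)
  have hC := mul_le C ((1 - p) * (1 - q)) (by nlinarith) (by nlinarith)
  have hD := mul_le D (p * (1 - q)) (by nlinarith) (by nlinarith)
  have hE := mul_le E ((1 - p) * q) (by nlinarith) (by nlinarith)
  refine (abs_add_le _ _).trans (add_le_add ((abs_add_le _ _).trans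
    (add_le_add ((abs_add_le _ _).trans (add_le_add hA hC)) hD)) hE)

lemma integral_corrector_expMeasure (hν : 0 < ν) {r : ℝ} (hr : 0 < r) :
    ∫ x, corrector μ ν σ A C D E x ∂(expMeasure r) = A * (ν / (r + ν)) := by
  have := isProbabilityMeasure_expMeasure hr
  have h : ∀ᵐ x ∂(expMeasure r),
      corrector μ ν σ A C D E x = A * (1 - Real.exp (-(ν * x))) := by
    filter_upwards [ae_pos_expMeasure hr] with x hx
    unfold corrector
    rw [max_eq_left hx.le, max_eq_right (by linarith)]
    simp
  rw [integral_congr_ae h, integral_const_mul,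
    integral_sub (integrable_const _) (integrable_exp_neg_mul_expMeasure hr hν.le),
    integral_exp_neg_mul_expMeasure hr hν.le]
  simp only [integral_const, probReal_univ, smul_eq_mul, mul_one]
  field_simp
  ring

/-- On the negative axis the corrector is a combination of `1` and exponentials of rates `μ`, `σ`,
`μ + σ`, so only Laplace transforms of `expMeasure σ` occur. This value becomes the auxiliary
unknown `G` of the linear system. -/
lemma integral_corrector_neg_expMeasure (hμ : 0 < μ) (hσ : 0 < σ) :
    ∫ x, corrector μ ν σ A C D E (-x) ∂(expMeasure σ) =
      C * (1 / 2 - σ / (σ + μ) + σ / (2 * σ + μ)) + D * (σ / (σ + μ) - σ / (2 * σ + μ)) +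
        E * (1 / 2 - σ / (2 * σ + μ)) := by
  have := isProbabilityMeasure_expMeasure hσ
  have h : ∀ᵐ x ∂(expMeasure σ), corrector μ ν σ A C D E (-x) =
      C + ((D - C) * Real.exp (-(μ * x)) + ((E - C) * Real.exp (-(σ * x)) +
        (C - D - E) * Real.exp (-((μ + σ) * x)))) := by
    filter_upwards [ae_pos_expMeasure hσ] with x hx
    have e : Real.exp (-((μ + σ) * x)) = Real.exp (-(μ * x)) * Real.exp (-(σ * x)) := by
      rw [← Real.exp_add]; ring_nf
    unfold corrector
    rw [max_eq_right (a := -x) (by linarith), neg_neg, max_eq_left hx.le, e]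
    simp only [mul_zero, neg_zero, Real.exp_zero]
    ring
  have hi := fun {c : ℝ} (hc : 0 ≤ c) (k : ℝ) =>
    (integrable_exp_neg_mul_expMeasure hσ hc).const_mul k
  have i₁ := hi hμ.le (D - C)
  have i₂ := hi hσ.le (E - C)
  have i₃ := hi (add_pos hμ hσ).le (C - D - E)
  have i₂₃ := i₂.add i₃
  have i₁₂₃ := i₁.add i₂₃
  simp only [Pi.add_def] at i₂₃ i₁₂₃
  rw [integral_congr_ae h, integral_add (integrable_const _) i₁₂₃, integral_add i₁ i₂₃,
    integral_add i₂ i₃, integral_const_mul, integral_const_mul, integral_const_mul,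
    integral_exp_neg_mul_expMeasure hσ hμ.le, integral_exp_neg_mul_expMeasure hσ hσ.le,
    integral_exp_neg_mul_expMeasure hσ (add_pos hμ hσ).le]
  simp only [integral_const, probReal_univ, smul_eq_mul]
  field_simp
  ring

end Corrector

/-- The corrected value of the state with coordinates `x` and `y`. -/
noncomputable def correctedMax (μ ν σ A C D E x y : ℝ) : ℝ :=
  max x y + corrector μ ν σ A C D E (x - y)

/-! ### Expectations of the corrected value at exponential arguments -/

section CorrectedMax

variable {Ω : Type*} [MeasurableSpace Ω] {P : Measure Ω} {μ ν σ : ℝ} (A C D E : ℝ)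

lemma measurable_correctedMax : Measurable (Function.uncurry (correctedMax μ ν σ A C D E)) :=
  (measurable_fst.max measurable_snd).add
    ((measurable_corrector A C D E).comp (measurable_fst.sub measurable_snd))

lemma integral_correctedMax_exp_zero {X : Ω → ℝ} {r : ℝ} (hXr : HasLaw X (expMeasure r) P)
    (hr : 0 < r) (hμ : 0 < μ) (hν : 0 < ν) (hσ : 0 < σ) :
    ∫ ω, correctedMax μ ν σ A C D E (X ω) 0 ∂P = 1 / r + A * (ν / (r + ν)) := by
  have := isProbabilityMeasure_expMeasure hr
  have e : ∀ᵐ ω ∂P, correctedMax μ ν σ A C D E (X ω) 0 =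
      X ω + corrector μ ν σ A C D E (X ω) := by
    filter_upwards [hXr.ae_pos_of_exp hr] with ω hω
    unfold correctedMax
    rw [max_eq_left hω.le, sub_zero]
  have ib : Integrable (corrector μ ν σ A C D E) (expMeasure r) :=
    Integrable.of_bound (measurable_corrector A C D E).aestronglyMeasurable _
      (ae_of_all _ fun ω => abs_corrector_le A C D E hμ hν hσ _)
  have e₂ := hXr.integral_comp (measurable_corrector (μ := μ) (ν := ν) (σ := σ)
    A C D E).aestronglyMeasurable
  simp only [Function.comp_def] at e₂
  rw [integral_congr_ae e, integral_add (hXr.integrable_of_exp hr)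
    ((hXr.integrable_comp_iff (measurable_corrector A C D E)).2 ib), hXr.integral_eq, e₂,
    integral_id_expMeasure hr, integral_corrector_expMeasure A C D E hν hr]

variable [IsProbabilityMeasure P]

lemma integrable_correctedMax (hμ : 0 < μ) (hν : 0 < ν) (hσ : 0 < σ) {X Y : Ω → ℝ}
    (hX : Integrable X P) (hY : Integrable Y P) :
    Integrable (fun ω => correctedMax μ ν σ A C D E (X ω) (Y ω)) P := by
  refine (hX.sup hY).add (Integrable.of_bound (C := |A| + |C| + |D| + |E|) ?_
    (ae_of_all _ fun ω => abs_corrector_le A C D E hμ hν hσ _))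
  exact ((measurable_corrector A C D E).comp_aemeasurable
    (hX.aemeasurable.sub hY.aemeasurable)).aestronglyMeasurable

/-- The maximum is `X + Y - min X Y` with an exponential minimum, and the corrector sees only `X -
Y`, a mixture of an exponential of rate `r` and a negated one of rate `σ`. -/
lemma integral_correctedMax_exp {X Y : Ω → ℝ} {r : ℝ} (h : IndepFun X Y P)
    (hX : Measurable X) (hY : Measurable Y) (hXr : HasLaw X (expMeasure r) P)
    (hYσ : HasLaw Y (expMeasure σ) P) (hr : 0 < r) (hμ : 0 < μ) (hν : 0 < ν) (hσ : 0 < σ) :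
    ∫ ω, correctedMax μ ν σ A C D E (X ω) (Y ω) ∂P =
      1 / r + 1 / σ - 1 / (r + σ) + σ / (r + σ) * (A * (ν / (r + ν))) +
      r / (r + σ) * (C * (1 / 2 - σ / (σ + μ) + σ / (2 * σ + μ)) +
        D * (σ / (σ + μ) - σ / (2 * σ + μ)) + E * (1 / 2 - σ / (2 * σ + μ))) := by
  have hlaw := hasLaw_min_exp h hX hY hXr hYσ hr hσ
  have iX := hXr.integrable_of_exp hr
  have iY := hYσ.integrable_of_exp hσ
  have ib : Integrable (fun ω => corrector μ ν σ A C D E (X ω - Y ω)) P :=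
    Integrable.of_bound ((measurable_corrector A C D E).comp
      (hX.sub hY)).aestronglyMeasurable _
      (ae_of_all _ fun ω => abs_corrector_le A C D E hμ hν hσ _)
  have e : ∀ ω, correctedMax μ ν σ A C D E (X ω) (Y ω) =
      X ω + (Y ω + (corrector μ ν σ A C D E (X ω - Y ω) - min (X ω) (Y ω))) := fun ω => by
    unfold correctedMax
    linarith [max_add_min (X ω) (Y ω)]
  have im := hlaw.integrable_of_exp (add_pos hr hσ)
  have i₁ : Integrable
    (fun ω => corrector μ ν σ A C D E (X ω - Y ω) - min (X ω) (Y ω)) P := ib.sub im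
  have i₂ : Integrable (fun ω => Y ω +
    (corrector μ ν σ A C D E (X ω - Y ω) - min (X ω) (Y ω))) P := iY.add i₁
  simp_rw [e]
  rw [integral_add iX i₂, integral_add iY i₁, integral_sub ib im, hXr.integral_eq, hYσ.integral_eq,
    hlaw.integral_eq, integral_id_expMeasure hr, integral_id_expMeasure hσ,
    integral_id_expMeasure (add_pos hr hσ),
    integral_comp_sub_exp h hX hY hXr hYσ hr hσ (measurable_corrector A C D E)
      (abs_corrector_le A C D E hμ hν hσ),
    integral_corrector_expMeasure A C D E hν hr, integral_corrector_neg_expMeasure A C D E hμ hσ]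
  ring

/-- Pointwise, `max` and `min` permute `X` and `Y`. This trades the maximum of two exponentials,
which is not exponential, for the minimum, which is. -/
lemma integral_correctedMax_max (hμ : 0 < μ) (hν : 0 < ν) (hσ : 0 < σ) {X Y Z : Ω → ℝ}
    (hX : Integrable X P) (hY : Integrable Y P) (hZ : Integrable Z P) :
    ∫ ω, correctedMax μ ν σ A C D E (max (X ω) (Y ω)) (Z ω) ∂P =
      ∫ ω, correctedMax μ ν σ A C D E (X ω) (Z ω) ∂P +
      ∫ ω, correctedMax μ ν σ A C D E (Y ω) (Z ω) ∂P -
      ∫ ω, correctedMax μ ν σ A C D E (min (X ω) (Y ω)) (Z ω) ∂P := by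
  have i := fun {U : Ω → ℝ} (hU : Integrable U P) =>
    integrable_correctedMax A C D E hμ hν hσ hU hZ
  have iXY : Integrable (fun ω => correctedMax μ ν σ A C D E (X ω) (Z ω) +
    correctedMax μ ν σ A C D E (Y ω) (Z ω)) P := (i hX).add (i hY)
  have hmin : Integrable (fun ω => min (X ω) (Y ω)) P := hX.inf hY
  rw [← integral_add (i hX) (i hY), ← integral_sub iXY (i hmin)]
  refine integral_congr_ae (ae_of_all _ fun ω => ?_)
  rcases le_total (X ω) (Y ω) with h | h
  · simp [max_eq_right h, min_eq_left h]
  · simp [max_eq_left h, min_eq_right h]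

end CorrectedMax

/-! ### One step of the system -/

/-- The corrected value of the state after one step with entries `w`, started from a state whose
coordinates have difference `d` and maximum `0`. -/
noncomputable def correctedStep (μ ν σ A C D E d : ℝ) (w : ℝ × ℝ × ℝ) : ℝ :=
  correctedMax μ ν σ A C D E
    (max (max (w.1 - max (-d) 0) 0) (max (w.2.1 - max d 0) 0)) (max (w.2.2 - max (-d) 0) 0)

section Step

variable {μ ν σ : ℝ} (A C D E : ℝ)

lemma measurable_correctedStep :
    Measurable (Function.uncurry (correctedStep μ ν σ A C D E)) := by
  unfold correctedStep Function.uncurry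
  exact (measurable_correctedMax A C D E).comp
    (f := fun p : ℝ × ℝ × ℝ × ℝ => (max (max (p.2.1 - max (-p.1) 0) 0)
      (max (p.2.2.1 - max p.1 0) 0), max (p.2.2.2 - max (-p.1) 0) 0)) (by fun_prop)

/-- The truncations at `0` in `correctedStep` lose nothing: the larger old coordinate receives a
nonnegative entry, so both new coordinates are at least the old maximum, except possibly the second
when `c` is cut off, where the old `v 1` itself is the maximum. -/
lemma correctedMax_maxPlusMulVec (v : Fin 2 → ℝ) {a b c : ℝ} (ha : 0 ≤ a) (hb : 0 ≤ b)
    (hc : 0 ≤ c) :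
    correctedMax μ ν σ A C D E (maxPlusMulVec !![a, b; c, 0] v 0)
      (maxPlusMulVec !![a, b; c, 0] v 1) =
    max (v 0) (v 1) + correctedStep μ ν σ A C D E (v 0 - v 1) (a, b, c) := by
  have h₀ : maxPlusMulVec !![a, b; c, 0] v 0 = max (v 0) (v 1) +
      max (max (a - max (-(v 0 - v 1)) 0) 0) (max (b - max (v 0 - v 1) 0) 0) := by
    simp only [maxPlusMulVec, Matrix.of_apply, Matrix.cons_val_zero, Matrix.cons_val_one]
    grind
  have h₁ : maxPlusMulVec !![a, b; c, 0] v 1 = max (v 0) (v 1) +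
      max (c - max (-(v 0 - v 1)) 0) 0 := by
    simp only [maxPlusMulVec, Matrix.of_apply, Matrix.cons_val_zero, Matrix.cons_val_one]
    grind
  rw [h₀, h₁]
  unfold correctedStep correctedMax
  rw [max_add_add_left, add_sub_add_left_eq_sub, add_assoc]

lemma abs_correctedStep_le (hμ : 0 < μ) (hν : 0 < ν) (hσ : 0 < σ) (d : ℝ) {a b c : ℝ}
    (ha : 0 ≤ a) (hb : 0 ≤ b) (hc : 0 ≤ c) :
    |correctedStep μ ν σ A C D E d (a, b, c)| ≤ a + b + c + (|A| + |C| + |D| + |E|) := by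
  unfold correctedStep correctedMax
  refine (abs_add_le _ _).trans (add_le_add ?_ (abs_corrector_le A C D E hμ hν hσ _))
  rw [abs_of_nonneg (le_max_of_le_right (le_max_right _ _))]
  have := le_max_right d 0
  have := le_max_right (-d) 0
  simp only [max_le_iff]
  refine ⟨⟨⟨?_, ?_⟩, ?_, ?_⟩, ?_, ?_⟩ <;> linarith

variable {Ω : Type*} [MeasurableSpace Ω] {P : Measure Ω} [IsProbabilityMeasure P]

/-- The Poisson equation for every `d`, reduced to five scalar equations: memorylessness removes the
truncations one at a time, and the resulting mixture weights are those in `corrector`. -/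
lemma integral_correctedStep {a b c : Ω → ℝ} {l : ℝ} (hμ : 0 < μ) (hν : 0 < ν) (hσ : 0 < σ)
    (ma : Measurable a) (mb : Measurable b) (mc : Measurable c)
    (ha : HasLaw a (expMeasure μ) P) (hb : HasLaw b (expMeasure ν) P)
    (hc : HasLaw c (expMeasure σ) P) (hbca : IndepFun (fun ω => (b ω, c ω)) a P)
    (hacb : IndepFun (fun ω => (a ω, c ω)) b P) (habc : IndepFun (fun ω => (a ω, b ω)) c P)
    (hA : ∫ ω, correctedMax μ ν σ A C D E (a ω) (c ω) ∂P = A + l)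
    (hE : ∫ ω, correctedMax μ ν σ A C D E (b ω) (c ω) ∂P = E + l)
    (hl : ∫ ω, correctedMax μ ν σ A C D E (max (a ω) (b ω)) (c ω) ∂P = l)
    (hC : ∫ ω, correctedMax μ ν σ A C D E (b ω) 0 ∂P = C + l)
    (hD : ∫ ω, correctedMax μ ν σ A C D E (max (a ω) (b ω)) 0 ∂P = D + l) (d : ℝ) :
    ∫ ω, correctedStep μ ν σ A C D E d (a ω, b ω, c ω) ∂P = corrector μ ν σ A C D E d + l := by
  have ia := ha.integrable_of_exp hμ
  have ib := hb.integrable_of_exp hν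
  have ic := hc.integrable_of_exp hσ
  have i := fun {X Y : Ω → ℝ} (hX : Integrable X P) (hY : Integrable Y P) =>
    integrable_correctedMax A C D E hμ hν hσ hX hY
  have k := fun t : ℝ => integrable_const (μ := P) t
  have s := fun {X Y : Ω → ℝ} (hX : Integrable X P) (hY : Integrable Y P) =>
    (hX.sup hY : Integrable (fun ω => max (X ω) (Y ω)) P)
  have t := fun {X : Ω → ℝ} (hX : Integrable X P) (r : ℝ) =>
    s (X := fun ω => X ω - r) (hX.sub (k r)) (k 0)
  have pa := ha.ae_pos_of_exp hμ
  have pb := hb.ae_pos_of_exp hν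
  have pc := hc.ae_pos_of_exp hσ
  have mH := measurable_correctedMax (μ := μ) (ν := ν) (σ := σ) A C D E
  unfold correctedStep
  rcases le_total 0 d with hd | hd
  -- For `d ≥ 0` only `b` is shortened; it is either suppressed (`hA`) or whole (`hl`).
  · have e₀ : ∫ ω, correctedMax μ ν σ A C D E (max (max (a ω - max (-d) 0) 0)
        (max (b ω - max d 0) 0)) (max (c ω - max (-d) 0) 0) ∂P =
        ∫ ω, correctedMax μ ν σ A C D E (max (a ω) (max (b ω - d) 0)) (c ω) ∂P := by
      refine integral_congr_ae ?_
      filter_upwards [pa, pc] with ω h₁ h₂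
      rw [max_eq_right (a := -d) (by linarith), max_eq_left hd, sub_zero, sub_zero,
        max_eq_left h₁.le, max_eq_left h₂.le]
    have e₁ : ∫ ω, correctedMax μ ν σ A C D E (max (a ω) 0) (c ω) ∂P = A + l := by
      rw [← hA]
      refine integral_congr_ae ?_
      filter_upwards [pa] with ω h₁
      rw [max_eq_left h₁.le]
    have := hacb.integral_comp_posPart_sub_const (ma.prodMk mc) mb hb hν hd
      (F := fun x y => correctedMax μ ν σ A C D E (max x.1 y) x.2)
      (mH.comp (((measurable_fst.comp measurable_fst).max measurable_snd).prodMk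
        (measurable_snd.comp measurable_fst)))
      (fun x => i (s (k _) ib) (k _)) (i (s ia (k _)) ic) (i (s ia ib) ic) (i (s ia (t ib d)) ic)
    simp only at this
    rw [e₀, this, e₁, hl]
    unfold corrector
    rw [max_eq_left hd, max_eq_right (by linarith)]
    simp only [mul_zero, neg_zero, Real.exp_zero]
    ring
  -- For `d ≤ 0` both `a` and `c` are shortened by `-d`: first `a` is resolved (`h₁`), then `c` with
  -- `a` present (`h₂`) or suppressed (`h₃`).
  · have e₀ : ∫ ω, correctedMax μ ν σ A C D E (max (max (a ω - max (-d) 0) 0)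
        (max (b ω - max d 0) 0)) (max (c ω - max (-d) 0) 0) ∂P =
        ∫ ω, correctedMax μ ν σ A C D E (max (max (a ω - -d) 0) (b ω))
          (max (c ω - -d) 0) ∂P := by
      refine integral_congr_ae ?_
      filter_upwards [pb] with ω h₁
      rw [max_eq_left (a := -d) (by linarith), max_eq_right hd, sub_zero, max_eq_left h₁.le]
    have hd' : 0 ≤ -d := by linarith
    have h₁ := hbca.integral_comp_posPart_sub_const (mb.prodMk mc) ma ha hμ hd'
      (F := fun x y => correctedMax μ ν σ A C D E (max y x.1) (max (x.2 - -d) 0))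
      (mH.comp ((measurable_snd.max (measurable_fst.comp measurable_fst)).prodMk
        (((measurable_snd.comp measurable_fst).sub_const _).max measurable_const)))
      (fun x => i (s ia (k _)) (k _)) (i (s (k _) ib) (t ic _)) (i (s ia ib) (t ic _))
      (i (s (t ia _) ib) (t ic _))
    have h₂ := habc.integral_comp_posPart_sub_const (ma.prodMk mb) mc hc hσ hd'
      (F := fun x y => correctedMax μ ν σ A C D E (max x.1 x.2) y)
      (mH.comp (((measurable_fst.comp measurable_fst).max
        (measurable_snd.comp measurable_fst)).prodMk measurable_snd))
      (fun x => i (k _) ic) (i (s ia ib) (k _)) (i (s ia ib) ic) (i (s ia ib) (t ic _))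
    have h₃ := habc.integral_comp_posPart_sub_const (ma.prodMk mb) mc hc hσ hd'
      (F := fun x y => correctedMax μ ν σ A C D E x.2 y)
      (mH.comp ((measurable_snd.comp measurable_fst).prodMk measurable_snd))
      (fun x => i (k _) ic) (i ib (k _)) (i ib ic) (i ib (t ic _))
    have e₁ : ∫ ω, correctedMax μ ν σ A C D E (max 0 (b ω)) (max (c ω - -d) 0) ∂P =
        ∫ ω, correctedMax μ ν σ A C D E (b ω) (max (c ω - -d) 0) ∂P := by
      refine integral_congr_ae ?_
      filter_upwards [pb] with ω h₁
      rw [max_eq_right h₁.le]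
    simp only at h₁ h₂ h₃
    rw [e₀, h₁, e₁, h₂, h₃, hl, hC, hD, hE]
    unfold corrector
    rw [max_eq_right hd, max_eq_left hd']
    simp only [mul_zero, neg_zero, Real.exp_zero]
    ring

end Step

/-! ### Sums of orthogonal increments -/

section Orthogonal

variable {Ω : Type*} [MeasurableSpace Ω] {P : Measure Ω}

/-- Cross terms vanish, so second moments add. Orthogonality is asked only under square
integrability of `S n`, which the same induction supplies. -/
lemma integral_sq_le_of_orthogonal_increments {S ξ : ℕ → Ω → ℝ} {K : ℝ} (h₀ : S 0 =ᵐ[P] 0)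
    (hS : ∀ n, S (n + 1) =ᵐ[P] S n + ξ n) (hξ : ∀ n, MemLp (ξ n) 2 P)
    (hK : ∀ n, ∫ ω, ξ n ω ^ 2 ∂P ≤ K)
    (horth : ∀ n, MemLp (S n) 2 P → ∫ ω, S n ω * ξ n ω ∂P = 0) (n : ℕ) :
    MemLp (S n) 2 P ∧ ∫ ω, S n ω ^ 2 ∂P ≤ K * n := by
  induction n with
  | zero =>
    refine ⟨(memLp_congr_ae h₀).2 MemLp.zero, le_of_eq ?_⟩
    rw [integral_eq_zero_of_ae]
    · simp
    · filter_upwards [h₀] with ω h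
      simp [h]
  | succ n ih =>
    obtain ⟨h₁, h₂⟩ := ih
    refine ⟨(memLp_congr_ae (hS n)).2 (h₁.add (hξ n)), ?_⟩
    have i₁ := h₁.integrable_sq
    have i₂ : Integrable (fun ω => S n ω * ξ n ω) P := h₁.integrable_mul (hξ n)
    have i₃ := (hξ n).integrable_sq
    have i₄ : Integrable (fun ω => 2 * (S n ω * ξ n ω) + ξ n ω ^ 2) P := (i₂.const_mul 2).add i₃
    have e : ∫ ω, S (n + 1) ω ^ 2 ∂P =
        ∫ ω, (S n ω ^ 2 + (2 * (S n ω * ξ n ω) + ξ n ω ^ 2)) ∂P := by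
      refine integral_congr_ae ?_
      filter_upwards [hS n] with ω h
      rw [h, Pi.add_apply]
      ring
    rw [e, integral_add i₁ i₄, integral_add (i₂.const_mul 2) i₃, integral_const_mul, horth n h₁]
    push_cast
    linarith [hK n]

/-- Along squares the second moments of the ratios are at most `K / n ^ 2`, hence summable; so the
series of squared ratios is almost surely finite and its terms tend to zero. -/
lemma ae_tendsto_div_sq_of_integral_sq_le {S : ℕ → Ω → ℝ} {K : ℝ} (hS : ∀ n, MemLp (S n) 2 P)
    (hK : ∀ n : ℕ, ∫ ω, S n ω ^ 2 ∂P ≤ K * n) :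
    ∀ᵐ ω ∂P, Tendsto (fun n : ℕ => S (n ^ 2) ω / ((n ^ 2 : ℕ) : ℝ)) atTop (𝓝 0) := by
  set f : ℕ → Ω → ENNReal :=
    fun n ω => ENNReal.ofReal ((S (n ^ 2) ω / ((n ^ 2 : ℕ) : ℝ)) ^ 2) with hf
  have hfm : ∀ n, AEMeasurable (f n) P := fun n =>
    (((hS (n ^ 2)).aestronglyMeasurable.aemeasurable.div_const _).pow_const 2).ennreal_ofReal
  have hle : ∀ n, ∫⁻ ω, f n ω ∂P ≤ ENNReal.ofReal (K * (1 / (n : ℝ) ^ 2)) := fun n => by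
    have hi : Integrable (fun ω => (S (n ^ 2) ω / ((n ^ 2 : ℕ) : ℝ)) ^ 2) P := by
      simp_rw [div_pow]
      exact (hS (n ^ 2)).integrable_sq.div_const _
    rw [hf, ← ofReal_integral_eq_lintegral_ofReal hi (ae_of_all _ fun ω => sq_nonneg _)]
    refine ENNReal.ofReal_le_ofReal ?_
    simp_rw [div_pow]
    rw [integral_div]
    rcases Nat.eq_zero_or_pos n with rfl | hn
    · simp
    · have hn' : (0 : ℝ) < n := by exact_mod_cast hn
      refine (div_le_div_of_nonneg_right (hK (n ^ 2)) (by positivity)).trans (le_of_eq ?_)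
      push_cast
      field_simp
  have hsum : ∫⁻ ω, ∑' n, f n ω ∂P ≠ ⊤ := by
    rw [lintegral_tsum hfm]
    refine ne_top_of_le_ne_top ?_ (ENNReal.tsum_le_tsum hle)
    exact ((Real.summable_one_div_nat_pow.2 one_lt_two).mul_left K).tsum_ofReal_ne_top
  filter_upwards [ae_lt_top' (AEMeasurable.tsum hfm) hsum] with ω hω
  have h := ENNReal.tendsto_atTop_zero_of_tsum_ne_top hω.ne
  have h₂ := (ENNReal.tendsto_toReal ENNReal.zero_ne_top).comp h
  simp only [hf, Function.comp_def, ENNReal.toReal_zero,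
    ENNReal.toReal_ofReal (sq_nonneg _)] at h₂
  have h₃ := h₂.sqrt
  simp only [Real.sqrt_sq_eq_abs, Real.sqrt_zero] at h₃
  exact (tendsto_zero_iff_abs_tendsto_zero _).2 h₃

/-- Consecutive squares have ratio tending to `1`, so monotonicity fills the gaps between them. -/
lemma tendsto_div_of_monotone_of_tendsto_sq {u : ℕ → ℝ} {l : ℝ} (hu : Monotone u)
    (h : Tendsto (fun n : ℕ => u (n ^ 2) / ((n ^ 2 : ℕ) : ℝ)) atTop (𝓝 l)) :
    Tendsto (fun n : ℕ => u n / n) atTop (𝓝 l) := by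
  refine tendsto_div_of_monotone_of_exists_subseq_tendsto_div u l hu fun a ha =>
    ⟨fun n => n ^ 2, ?_, tendsto_pow_atTop two_ne_zero, h⟩
  have h₁ : Tendsto (fun n : ℕ => (1 + 1 / (n : ℝ)) ^ 2) atTop (𝓝 1) := by
    simpa using ((tendsto_one_div_atTop_nhds_zero_nat (𝕜 := ℝ)).const_add 1).pow 2
  filter_upwards [h₁.eventually_le_const ha, eventually_gt_atTop 0] with n hn h₀
  have h₀' : (0 : ℝ) < n := by exact_mod_cast h₀
  push_cast
  calc ((n : ℝ) + 1) ^ 2 = (1 + 1 / (n : ℝ)) ^ 2 * (n : ℝ) ^ 2 := by field_simp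
    _ ≤ a * (n : ℝ) ^ 2 := by gcongr

end Orthogonal

/-! ### Trajectories of the system -/

lemma maxPlusState_congr {A B : ℕ → Matrix (Fin 2) (Fin 2) ℝ} {n : ℕ}
    (h : ∀ j < n, A j = B j) : maxPlusState A n = maxPlusState B n := by
  induction n with
  | zero => rfl
  | succ n ih =>
    rw [maxPlusState, maxPlusState, ih fun j hj => h j (hj.trans n.lt_succ_self),
      h n n.lt_succ_self]

lemma measurable_maxPlusState {Ω : Type*} [MeasurableSpace Ω] {a b c : ℕ → Ω → ℝ}
    (ha : ∀ k, Measurable (a k)) (hb : ∀ k, Measurable (b k)) (hc : ∀ k, Measurable (c k))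
    (n : ℕ) : Measurable fun ω => maxPlusState (fun j => !![a j ω, b j ω; c j ω, 0]) n := by
  induction n with
  | zero => exact measurable_const
  | succ n ih =>
    have h := fun i => (measurable_pi_apply (X := fun _ : Fin 2 => ℝ) i).comp ih
    simp only [Function.comp_def] at h
    refine measurable_pi_lambda _ fun i => ?_
    simp only [maxPlusState, maxPlusMulVec]
    fin_cases i
    · simpa using ((h 0).add (ha n)).max ((h 1).add (hb n))
    · simpa using ((h 0).add (hc n)).max (h 1)

lemma max_maxPlusState_le_succ {A : ℕ → Matrix (Fin 2) (Fin 2) ℝ} (h₀ : ∀ k, 0 ≤ A k 0 0)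
    (h₁ : ∀ k, 0 ≤ A k 1 1) (n : ℕ) :
    max (maxPlusState A n 0) (maxPlusState A n 1) ≤
      max (maxPlusState A (n + 1) 0) (maxPlusState A (n + 1) 1) := by
  simp only [maxPlusState, maxPlusMulVec]
  have := h₀ n
  have := h₁ n
  grind

/-- The state at time `n` is a measurable function of the entries with time index below `n`, a block
disjoint from the entries at time `n`. -/
lemma indepFun_maxPlusState {Ω : Type*} [MeasurableSpace Ω] {P : Measure Ω}
    {α β γ : ℕ → Ω → ℝ}
    (hm : ∀ p : Fin 3 × ℕ, Measurable (![α, β, γ] p.1 p.2))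
    (hindep : iIndepFun (fun p : Fin 3 × ℕ => ![α, β, γ] p.1 p.2) P) (n : ℕ) :
    IndepFun (fun ω => maxPlusState (fun j => !![α j ω, β j ω; γ j ω, 0]) n)
      (fun ω => (α n ω, β n ω, γ n ω)) P := by
  classical
  set S : Finset (Fin 3 × ℕ) := Finset.univ ×ˢ Finset.range n
  set T : Finset (Fin 3 × ℕ) := Finset.univ ×ˢ {n}
  have hST : Disjoint S T := by
    rw [Finset.disjoint_left]
    intro p hp hq
    simp only [S, T, Finset.mem_product, Finset.mem_univ, true_and, Finset.mem_range,
      Finset.mem_singleton] at hp hq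
    exact hp.ne hq
  have h := hindep.indepFun_finset S T hST hm
  have hT : ∀ i : Fin 3, (i, n) ∈ T := fun i => by simp [T]
  -- Extends the finite block to full sequences; the default `0` is never read by the state at time
  -- `n`.
  let e : (S → ℝ) → Fin 3 → ℕ → ℝ := fun v i j => if h : (i, j) ∈ S then v ⟨(i, j), h⟩ else 0
  have he : ∀ i j, Measurable fun v => e v i j := fun i j => by
    by_cases h : (i, j) ∈ S
    · simp only [e, h, dite_true]
      exact measurable_pi_apply _
    · simp only [e, h, dite_false]
      exact measurable_const
  have hφ := measurable_maxPlusState (fun j => he 0 j) (fun j => he 1 j) (fun j => he 2 j) n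
  have hψ : Measurable fun v : T → ℝ => (v ⟨_, hT 0⟩, v ⟨_, hT 1⟩, v ⟨_, hT 2⟩) :=
    (measurable_pi_apply _).prodMk ((measurable_pi_apply _).prodMk (measurable_pi_apply _))
  convert h.comp hφ hψ using 1
  swap
  · rfl
  ext1 ω
  refine maxPlusState_congr fun j hj => ?_
  have hS : ∀ i : Fin 3, (i, j) ∈ S := fun i => by simp [S, hj]
  simp [e, hS]

lemma tendsto_div_of_monotone_of_corrected {u c : ℕ → ℝ} {B l : ℝ} (hu : Monotone u)
    (hc : ∀ n, |c n| ≤ B)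
    (h : Tendsto (fun n : ℕ => (u (n ^ 2) + c (n ^ 2) - l * (n ^ 2 : ℕ)) / ((n ^ 2 : ℕ) : ℝ))
      atTop (𝓝 0)) :
    Tendsto (fun n : ℕ => (1 / (n : ℝ)) * u n) atTop (𝓝 l) := by
  have hcorr : Tendsto (fun n : ℕ => c (n ^ 2) / ((n ^ 2 : ℕ) : ℝ)) atTop (𝓝 0) := by
    refine squeeze_zero_norm (a := fun n : ℕ => B / ((n ^ 2 : ℕ) : ℝ)) (fun n => ?_)
      (tendsto_const_nhds.div_atTop
        (tendsto_natCast_atTop_atTop.comp (tendsto_pow_atTop two_ne_zero)))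
    rw [norm_div, Real.norm_eq_abs, Real.norm_natCast]
    exact div_le_div_of_nonneg_right (hc _) (Nat.cast_nonneg _)
  simp_rw [one_div_mul_eq_div]
  refine tendsto_div_of_monotone_of_tendsto_sq hu ?_
  have h' := (h.sub hcorr).add_const l
  rw [sub_zero, zero_add] at h'
  refine h'.congr' ?_
  filter_upwards [eventually_gt_atTop 0] with n hn
  have hn' : ((n ^ 2 : ℕ) : ℝ) ≠ 0 := by positivity
  field_simp
  ring

lemma sq_le_of_abs_le_add {x a b c t : ℝ} (h : |x| ≤ a + b + c + t) :
    x ^ 2 ≤ 4 * (a ^ 2 + b ^ 2 + c ^ 2) + 4 * t ^ 2 := by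
  refine (sq_le_sq' (neg_le_of_abs_le h) (le_of_abs_le h)).trans ?_
  nlinarith [sq_nonneg (a - b), sq_nonneg (a - c), sq_nonneg (a - t), sq_nonneg (b - c),
    sq_nonneg (b - t), sq_nonneg (c - t)]

/-! ### From the Poisson equation to the almost sure limit -/

section Lyapunov

variable {Ω : Type*} [MeasurableSpace Ω] {P : Measure Ω} [IsProbabilityMeasure P]

/-- Increments driven by fresh noise and centred for each frozen state are orthogonal to any
square-integrable function of the current state. -/
lemma integral_sq_le_of_indepFun {E E' : Type*} [MeasurableSpace E] [MeasurableSpace E']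
    {z : ℕ → Ω → E} {W : ℕ → Ω → E'} (mz : ∀ n, Measurable (z n)) (mW : ∀ n, Measurable (W n))
    (hind : ∀ n, IndepFun (z n) (W n) P) {s : ℕ → E → ℝ} {x : E → E' → ℝ} {K : ℝ}
    (ms : ∀ n, Measurable (s n)) (mx : Measurable (Function.uncurry x))
    (hzero : (fun ω => s 0 (z 0 ω)) =ᵐ[P] 0)
    (hsucc : ∀ n, (fun ω => s (n + 1) (z (n + 1) ω)) =ᵐ[P]
      (fun ω => s n (z n ω)) + fun ω => x (z n ω) (W n ω))
    (hξ : ∀ n, MemLp (fun ω => x (z n ω) (W n ω)) 2 P)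
    (hξK : ∀ n, ∫ ω, x (z n ω) (W n ω) ^ 2 ∂P ≤ K)
    (hx₀ : ∀ n v, ∫ ω, x v (W n ω) ∂P = 0) (n : ℕ) :
    MemLp (fun ω => s n (z n ω)) 2 P ∧ ∫ ω, s n (z n ω) ^ 2 ∂P ≤ K * n := by
  refine integral_sq_le_of_orthogonal_increments (S := fun n ω => s n (z n ω)) hzero hsucc hξ hξK
    (fun n hn => ?_) n
  have hf : Measurable (Function.uncurry fun v w => s n v * x v w) :=
    ((ms n).comp measurable_fst).mul mx
  rw [(hind n).integral_comp_prodMk (mz n) (mW n) hf (hn.integrable_mul (hξ n))]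
  simp [integral_const_mul, hx₀]

/-- The Lyapunov exponent from a solution of the Poisson equation. -/
lemma isLyapunovExponent_of_poisson {μ ν σ l A C D E K : ℝ} (hμ : 0 < μ) (hν : 0 < ν)
    (hσ : 0 < σ) {α β γ : ℕ → Ω → ℝ} (hm : ∀ p : Fin 3 × ℕ, Measurable (![α, β, γ] p.1 p.2))
    (hα : ∀ k, ∀ᵐ ω ∂P, 0 < α k ω) (hβ : ∀ k, ∀ᵐ ω ∂P, 0 < β k ω)
    (hγ : ∀ k, ∀ᵐ ω ∂P, 0 < γ k ω)
    (hindep : iIndepFun (fun p : Fin 3 × ℕ => ![α, β, γ] p.1 p.2) P)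
    (iα : ∀ k, MemLp (α k) 2 P) (iβ : ∀ k, MemLp (β k) 2 P) (iγ : ∀ k, MemLp (γ k) 2 P)
    (hK : ∀ k, ∫ ω, (α k ω ^ 2 + β k ω ^ 2 + γ k ω ^ 2) ∂P ≤ K)
    (hP : ∀ k d, ∫ ω, correctedStep μ ν σ A C D E d (α k ω, β k ω, γ k ω) ∂P =
      corrector μ ν σ A C D E d + l) :
    IsLyapunovExponent P (fun k ω => !![α k ω, β k ω; γ k ω, 0]) l := by
  have mα : ∀ k, Measurable (α k) := fun k => hm (0, k)
  have mβ : ∀ k, Measurable (β k) := fun k => hm (1, k)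
  have mγ : ∀ k, Measurable (γ k) := fun k => hm (2, k)
  set z : ℕ → Ω → Fin 2 → ℝ :=
    fun n ω => maxPlusState (fun j => !![α j ω, β j ω; γ j ω, 0]) n with hz
  have mz : ∀ n, Measurable (z n) := fun n => measurable_maxPlusState mα mβ mγ n
  set B : ℝ := |A| + |C| + |D| + |E|
  set s : ℕ → (Fin 2 → ℝ) → ℝ := fun n v => correctedMax μ ν σ A C D E (v 0) (v 1) - l * n with hs
  -- The increment of the martingale `s n (z n)`; the Poisson equation says it has mean zero for
  -- each fixed `v`.
  set x : (Fin 2 → ℝ) → ℝ × ℝ × ℝ → ℝ := fun v w =>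
    correctedStep μ ν σ A C D E (v 0 - v 1) w - corrector μ ν σ A C D E (v 0 - v 1) - l with hx
  have mcoord : Measurable fun v : Fin 2 → ℝ => v 0 - v 1 := by fun_prop
  have ms : ∀ n, Measurable (s n) := fun n =>
    ((measurable_correctedMax A C D E).comp
      (f := fun v : Fin 2 → ℝ => (v 0, v 1)) (by fun_prop)).sub_const _
  have mx : Measurable (Function.uncurry x) :=
    (((measurable_correctedStep A C D E).comp
      ((mcoord.comp measurable_fst).prodMk measurable_snd)).sub
      ((measurable_corrector A C D E).comp (mcoord.comp measurable_fst))).sub_const _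
  set W : ℕ → Ω → ℝ × ℝ × ℝ := fun n ω => (α n ω, β n ω, γ n ω) with hW
  have mW : ∀ n, Measurable (W n) := fun n => (mα n).prodMk ((mβ n).prodMk (mγ n))
  have mξ : ∀ n, Measurable fun ω => x (z n ω) (W n ω) := fun n => mx.comp ((mz n).prodMk (mW n))
  have bx : ∀ n, ∀ᵐ ω ∂P, ∀ v, |x v (W n ω)| ≤ α n ω + β n ω + γ n ω + (2 * B + |l|) :=
    fun n => by
      filter_upwards [hα n, hβ n, hγ n] with ω h₁ h₂ h₃ v
      have e₁ := abs_correctedStep_le A C D E hμ hν hσ (v 0 - v 1) h₁.le h₂.le h₃.le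
      have e₂ := abs_corrector_le A C D E hμ hν hσ (v 0 - v 1)
      exact (abs_sub _ _).trans ((add_le_add ((abs_sub _ _).trans (add_le_add e₁ e₂)) le_rfl).trans
        (by linarith))
  have hdom : ∀ n, MemLp (fun ω => α n ω + β n ω + γ n ω + (2 * B + |l|)) 2 P := fun n =>
    (((iα n).add (iβ n)).add (iγ n)).add (memLp_const _)
  have hξ : ∀ n, MemLp (fun ω => x (z n ω) (W n ω)) 2 P := fun n => by
    refine (hdom n).mono' (mξ n).aestronglyMeasurable ?_
    filter_upwards [bx n] with ω h using h _
  have hxv : ∀ n v, Integrable (fun ω => x v (W n ω)) P := fun n v => by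
    refine ((hdom n).integrable one_le_two).mono'
      (mx.of_uncurry_left.comp (mW n)).aestronglyMeasurable ?_
    filter_upwards [bx n] with ω h using h _
  have hx₀ : ∀ n v, ∫ ω, x v (W n ω) ∂P = 0 := fun n v => by
    have h := hP n (v 0 - v 1)
    have e : ∀ ω, correctedStep μ ν σ A C D E (v 0 - v 1) (α n ω, β n ω, γ n ω) =
        x v (W n ω) + (corrector μ ν σ A C D E (v 0 - v 1) + l) := fun ω => by
      simp only [hx, hW]; ring
    simp_rw [e] at h
    rw [integral_add (hxv n v) (integrable_const _)] at h
    simpa using h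
  have hξK : ∀ n, ∫ ω, x (z n ω) (W n ω) ^ 2 ∂P ≤ 4 * K + 4 * (2 * B + |l|) ^ 2 := fun n => by
    have i₁ : Integrable (fun ω => α n ω ^ 2 + β n ω ^ 2 + γ n ω ^ 2) P :=
      ((iα n).integrable_sq.add (iβ n).integrable_sq).add (iγ n).integrable_sq
    calc ∫ ω, x (z n ω) (W n ω) ^ 2 ∂P
        ≤ ∫ ω, (4 * (α n ω ^ 2 + β n ω ^ 2 + γ n ω ^ 2) + 4 * (2 * B + |l|) ^ 2) ∂P := by
          refine integral_mono_ae (hξ n).integrable_sq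
            ((i₁.const_mul 4).add (integrable_const _)) ?_
          filter_upwards [bx n] with ω h
          exact sq_le_of_abs_le_add (h _)
      _ = 4 * ∫ ω, (α n ω ^ 2 + β n ω ^ 2 + γ n ω ^ 2) ∂P + 4 * (2 * B + |l|) ^ 2 := by
          rw [integral_add (i₁.const_mul 4) (integrable_const _), integral_const_mul]
          simp
      _ ≤ _ := by linarith [hK n]
  have hsucc : ∀ n, (fun ω => s (n + 1) (z (n + 1) ω)) =ᵐ[P]
      (fun ω => s n (z n ω)) + fun ω => x (z n ω) (W n ω) := fun n => by
    filter_upwards [hα n, hβ n, hγ n] with ω h₁ h₂ h₃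
    have e := correctedMax_maxPlusMulVec (μ := μ) (ν := ν) (σ := σ) A C D E (z n ω)
      h₁.le h₂.le h₃.le
    have e' : z (n + 1) ω = maxPlusMulVec !![α n ω, β n ω; γ n ω, 0] (z n ω) := rfl
    rw [← e'] at e
    simp only [hs, hx, hW, Pi.add_apply]
    rw [e]
    unfold correctedMax
    push_cast
    ring
  have hzero : (fun ω => s 0 (z 0 ω)) =ᵐ[P] 0 := ae_of_all _ fun ω => by
    simp [hs, hz, maxPlusState, correctedMax, corrector_zero]
  have hbound := integral_sq_le_of_indepFun mz mW (indepFun_maxPlusState hm hindep) ms mx hzero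
    hsucc hξ hξK hx₀
  filter_upwards [ae_tendsto_div_sq_of_integral_sq_le (fun n => (hbound n).1)
    (fun n => (hbound n).2), ae_all_iff.2 hα] with ω hω hαω
  have hmono : Monotone fun n => max (z n ω 0) (z n ω 1) := monotone_nat_of_le_succ fun n =>
    max_maxPlusState_le_succ (fun k => by simpa using (hαω k).le) (fun k => by simp) n
  simp only [hs, correctedMax] at hω
  have key := tendsto_div_of_monotone_of_corrected
    (c := fun n => corrector μ ν σ A C D E (z n ω 0 - z n ω 1)) hmono
    (fun n => abs_corrector_le A C D E hμ hν hσ _) hω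
  exact key

/-- The Lyapunov exponent from a solution of a linear system for the coefficients of the
corrector. -/
lemma isLyapunovExponent_of_exp {μ ν σ l A C D E G : ℝ} (hμ : 0 < μ) (hν : 0 < ν)
    (hσ : 0 < σ) {α β γ : ℕ → Ω → ℝ}
    (hα : ∀ k, HasLaw (α k) (expMeasure μ) P) (hβ : ∀ k, HasLaw (β k) (expMeasure ν) P)
    (hγ : ∀ k, HasLaw (γ k) (expMeasure σ) P)
    (hindep : iIndepFun (fun p : Fin 3 × ℕ => ![α, β, γ] p.1 p.2) P)
    (hG : C * (1 / 2 - σ / (σ + μ) + σ / (2 * σ + μ)) + D * (σ / (σ + μ) - σ / (2 * σ + μ)) +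
        E * (1 / 2 - σ / (2 * σ + μ)) = G)
    (hA : 1 / μ + 1 / σ - 1 / (μ + σ) + σ / (μ + σ) * (A * (ν / (μ + ν))) +
      μ / (μ + σ) * G = A + l)
    (hE : 1 / ν + 1 / σ - 1 / (ν + σ) + σ / (ν + σ) * (A * (ν / (ν + ν))) +
      ν / (ν + σ) * G = E + l)
    (hl : A + l + (E + l) - (1 / (μ + ν) + 1 / σ - 1 / (μ + ν + σ) +
      σ / (μ + ν + σ) * (A * (ν / (μ + ν + ν))) + (μ + ν) / (μ + ν + σ) * G) = l)
    (hC : 1 / ν + A * (ν / (ν + ν)) = C + l)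
    (hD : 1 / μ + A * (ν / (μ + ν)) + (C + l) -
      (1 / (μ + ν) + A * (ν / (μ + ν + ν))) = D + l) :
    IsLyapunovExponent P (fun k ω => !![α k ω, β k ω; γ k ω, 0]) l := by
  -- `HasLaw` gives only almost everywhere measurability. Countably many variables are involved, so
  -- measurable versions have almost surely the same trajectory.
  wlog hm : ∀ p : Fin 3 × ℕ, Measurable (![α, β, γ] p.1 p.2) generalizing α β γ
  · have hα' := fun k => (hα k).aemeasurable
    have hβ' := fun k => (hβ k).aemeasurable
    have hγ' := fun k => (hγ k).aemeasurable
    have h := this (α := fun k => (hα' k).mk) (β := fun k => (hβ' k).mk)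
      (γ := fun k => (hγ' k).mk) (fun k => (hα k).congr (hα' k).ae_eq_mk.symm)
      (fun k => (hβ k).congr (hβ' k).ae_eq_mk.symm) (fun k => (hγ k).congr (hγ' k).ae_eq_mk.symm)
      (hindep.congr fun ⟨i, k⟩ => by
        fin_cases i
        exacts [(hα' k).ae_eq_mk, (hβ' k).ae_eq_mk, (hγ' k).ae_eq_mk])
      (fun ⟨i, k⟩ => by
        fin_cases i
        exacts [(hα' k).measurable_mk, (hβ' k).measurable_mk, (hγ' k).measurable_mk])
    filter_upwards [h, ae_all_iff.2 fun k => (hα' k).ae_eq_mk,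
      ae_all_iff.2 fun k => (hβ' k).ae_eq_mk, ae_all_iff.2 fun k => (hγ' k).ae_eq_mk]
      with ω hω h₁ h₂ h₃
    simpa only [h₁, h₂, h₃] using hω
  have mα : ∀ k, Measurable (α k) := fun k => hm (0, k)
  have mβ : ∀ k, Measurable (β k) := fun k => hm (1, k)
  have mγ : ∀ k, Measurable (γ k) := fun k => hm (2, k)
  have memLp : ∀ {X : Ω → ℝ} {r : ℝ}, Measurable X → HasLaw X (expMeasure r) P → 0 < r →
      MemLp X 2 P := fun mX hX hr =>
    (memLp_two_iff_integrable_sq mX.aestronglyMeasurable).2 (hX.integrable_pow_of_exp hr 2)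
  have hsq : ∀ {X : Ω → ℝ} {r : ℝ}, HasLaw X (expMeasure r) P →
      ∫ ω, X ω ^ 2 ∂P = ∫ x, x ^ 2 ∂(expMeasure r) := fun hX =>
    hX.integral_comp (f := fun x => x ^ 2) (measurable_id.pow_const 2).aestronglyMeasurable
  refine isLyapunovExponent_of_poisson (A := A) (C := C) (D := D) (E := E)
    (K := ∫ x, x ^ 2 ∂(expMeasure μ) + ∫ x, x ^ 2 ∂(expMeasure ν) + ∫ x, x ^ 2 ∂(expMeasure σ))
    hμ hν hσ hm (fun k => (hα k).ae_pos_of_exp hμ) (fun k => (hβ k).ae_pos_of_exp hν)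
    (fun k => (hγ k).ae_pos_of_exp hσ) hindep (fun k => memLp (mα k) (hα k) hμ)
    (fun k => memLp (mβ k) (hβ k) hν) (fun k => memLp (mγ k) (hγ k) hσ) (fun k => ?_)
    (fun k d => ?_)
  · have i₁ := (hα k).integrable_pow_of_exp hμ 2
    have i₂ := (hβ k).integrable_pow_of_exp hν 2
    have i₃ := (hγ k).integrable_pow_of_exp hσ 2
    have i₁₂ : Integrable (fun ω => α k ω ^ 2 + β k ω ^ 2) P := i₁.add i₂
    rw [integral_add i₁₂ i₃, integral_add i₁ i₂, hsq (hα k), hsq (hβ k), hsq (hγ k)]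
  · have hbca : IndepFun (fun ω => (β k ω, γ k ω)) (α k) P :=
      hindep.indepFun_prodMk hm (1, k) (2, k) (0, k) (by simp) (by simp)
    have hacb : IndepFun (fun ω => (α k ω, γ k ω)) (β k) P :=
      hindep.indepFun_prodMk hm (0, k) (2, k) (1, k) (by simp) (by simp)
    have habc : IndepFun (fun ω => (α k ω, β k ω)) (γ k) P :=
      hindep.indepFun_prodMk hm (0, k) (1, k) (2, k) (by simp) (by simp)
    have hab : IndepFun (α k) (β k) P := hacb.comp measurable_fst measurable_id
    have hac : IndepFun (α k) (γ k) P := habc.comp measurable_fst measurable_id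
    have hbc : IndepFun (β k) (γ k) P := habc.comp measurable_snd measurable_id
    have hmc : IndepFun (fun ω => min (α k ω) (β k ω)) (γ k) P :=
      habc.comp (φ := fun p : ℝ × ℝ => min p.1 p.2) (measurable_fst.min measurable_snd) measurable_id
    have hmin := hasLaw_min_exp hab (mα k) (mβ k) (hα k) (hβ k) hμ hν
    have iα := (hα k).integrable_of_exp hμ
    have iβ := (hβ k).integrable_of_exp hν
    have iγ := (hγ k).integrable_of_exp hσ
    have hA' := integral_correctedMax_exp A C D E hac (mα k) (mγ k) (hα k) (hγ k) hμ hμ hν hσ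
    have hE' := integral_correctedMax_exp A C D E hbc (mβ k) (mγ k) (hβ k) (hγ k) hν hμ hν hσ
    have hl' := integral_correctedMax_exp A C D E hmc ((mα k).min (mβ k)) (mγ k) hmin (hγ k)
      (add_pos hμ hν) hμ hν hσ
    have hC' := integral_correctedMax_exp_zero A C D E (hβ k) hν hμ hν hσ
    have hα₀ := integral_correctedMax_exp_zero A C D E (hα k) hμ hμ hν hσ
    have hmin₀ := integral_correctedMax_exp_zero A C D E hmin (add_pos hμ hν) hμ hν hσ
    rw [hG] at hA' hE' hl'
    rw [hA] at hA'
    rw [hE] at hE'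
    rw [hC] at hC'
    refine integral_correctedStep A C D E hμ hν hσ (mα k) (mβ k) (mγ k) (hα k) (hβ k) (hγ k)
      hbca hacb habc hA' hE' ?_ hC' ?_ d
    · rw [integral_correctedMax_max A C D E hμ hν hσ iα iβ iγ, hA', hE', hl', hl]
    · rw [integral_correctedMax_max A C D E hμ hν hσ iα iβ (integrable_const 0), hC', hα₀, hmin₀,
        hD]

end Lyapunov

theorem mainTheorem6 {Ω : Type*} [MeasurableSpace Ω] (P : Measure Ω) [IsProbabilityMeasure P]
    (μ ν σ : ℝ) (hμ : 0 < μ) (hν : 0 < ν) (hσ : 0 < σ)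
    (α β γ : ℕ → Ω → ℝ)
    (hα : ∀ k, HasLaw (α k) (expMeasure μ) P)
    (hβ : ∀ k, HasLaw (β k) (expMeasure ν) P)
    (hγ : ∀ k, HasLaw (γ k) (expMeasure σ) P)
    (hindep : iIndepFun (fun p : Fin 3 × ℕ => ![α, β, γ] p.1 p.2) P) :
    (σ = μ →
      IsLyapunovExponent P (fun k ω => !![α k ω, β k ω; γ k ω, 0])
        ((48 * μ ^ 5 + 238 * μ ^ 4 * ν + 495 * μ ^ 3 * ν ^ 2 + 581 * μ ^ 2 * ν ^ 3
            + 326 * μ * ν ^ 4 + 68 * ν ^ 5) /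
          (2 * μ * ν * (36 * μ ^ 4 + 147 * μ ^ 3 * ν + 215 * μ ^ 2 * ν ^ 2
            + 130 * μ * ν ^ 3 + 28 * ν ^ 4)))) ∧
    (σ = ν →
      IsLyapunovExponent P (fun k ω => !![α k ω, β k ω; γ k ω, 0])
        ((15 * μ ^ 8 + 152 * μ ^ 7 * ν + 624 * μ ^ 6 * ν ^ 2 + 1382 * μ ^ 5 * ν ^ 3
            + 1838 * μ ^ 4 * ν ^ 4 + 1592 * μ ^ 3 * ν ^ 5 + 973 * μ ^ 2 * ν ^ 6
            + 384 * μ * ν ^ 7 + 64 * ν ^ 8) /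
          (μ * ν * (μ + ν) ^ 2 * (12 * μ ^ 5 + 97 * μ ^ 4 * ν + 286 * μ ^ 3 * ν ^ 2
            + 397 * μ ^ 2 * ν ^ 3 + 256 * μ * ν ^ 4 + 64 * ν ^ 5)))) := by

  constructor
  · rintro rfl
    set Q : ℝ := 2 * σ * ν * (36 * σ ^ 4 + 147 * σ ^ 3 * ν + 215 * σ ^ 2 * ν ^ 2
      + 130 * σ * ν ^ 3 + 28 * ν ^ 4) with hQ
    have hQ₀ : Q ≠ 0 := by positivity
    -- `C`, `D`, `E` are defined by their own equations through `eq_add_of_sub_eq rfl`. The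
    -- equations `hG`, `hA`, `hl` then form a linear system in `A`, `G`, `l`, and the displayed
    -- fractions over the common denominator `Q` are its solution.
    refine isLyapunovExponent_of_exp
      (A := -(48 * σ ^ 5 + 160 * σ ^ 4 * ν + 144 * σ ^ 3 * ν ^ 2 + 32 * σ ^ 2 * ν ^ 3) / Q)
      (G := -(12 * σ ^ 4 * ν + 68 * σ ^ 3 * ν ^ 2 + 160 * σ ^ 2 * ν ^ 3 + 128 * σ * ν ^ 4
        + 32 * ν ^ 5) / Q)
      hσ hν hσ hα hβ hγ hindep ?_ ?_ (eq_add_of_sub_eq rfl) ?_ (eq_add_of_sub_eq rfl)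
      (eq_add_of_sub_eq rfl)
    all_goals
      field_simp
      rw [hQ]
      ring
  · rintro rfl
    set Q : ℝ := μ * σ * (μ + σ) ^ 2 * (12 * μ ^ 5 + 97 * μ ^ 4 * σ + 286 * μ ^ 3 * σ ^ 2
      + 397 * μ ^ 2 * σ ^ 3 + 256 * μ * σ ^ 4 + 64 * σ ^ 5) with hQ
    have hQ₀ : Q ≠ 0 := by positivity
    refine isLyapunovExponent_of_exp
      (A := -(6 * μ ^ 8 + 58 * μ ^ 7 * σ + 222 * μ ^ 6 * σ ^ 2 + 438 * μ ^ 5 * σ ^ 3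
        + 476 * μ ^ 4 * σ ^ 4 + 272 * μ ^ 3 * σ ^ 5 + 64 * μ ^ 2 * σ ^ 6) / Q)
      (G := -(3 * μ ^ 8 + 30 * μ ^ 7 * σ + 123 * μ ^ 6 * σ ^ 2 + 281 * μ ^ 5 * σ ^ 3
        + 418 * μ ^ 4 * σ ^ 4 + 425 * μ ^ 3 * σ ^ 5 + 256 * μ ^ 2 * σ ^ 6
        + 64 * μ * σ ^ 7) / Q)
      hμ hσ hσ hα hβ hγ hindep ?_ ?_ (eq_add_of_sub_eq rfl) ?_ (eq_add_of_sub_eq rfl)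
      (eq_add_of_sub_eq rfl)
    -- `Q` stays an opaque nonzero atom while denominators are cleared, and is expanded only for the
    -- final polynomial identity.
    all_goals
      field_simp
      rw [hQ]
      ring
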